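/- Let $X$ be a real Banach space with the $\lambda \mathrm{Id}+S$-property: every bounded linear operator $T\colon X\to X$ can be written as $T=\lambda\,\mathrm{Id}+S$ with $\lambda\in\mathbb{R}$ and $S\colon X\to X$ a strictly singular bounded linear operator. (A bounded linear operator $S$ is strictly singular if there is no infinite-dimensional closed subspace $Y\subseteq X$ such that $S|_Y$ is an isomorphism onto its image, i.e. such that $\|Sy\|\ge c\|y\|$ for all $y\in Y$ and some $c>0$.) Let $T\colon X\to X$ be a bounded linear operator which is an isometry, i.e. $\|Tx\|=\|x\|$ for all $x\in X$ (surjectivity is not assumed). Then there is a compact linear operator $K\colon X\to X$ such that $T=\mathrm{Id}+K$ or $T=-\mathrm{Id}+K$. -/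

import Mathlib

/-- A bounded operator is strictly singular if its restriction to a closed subspace `Y` can be an
isomorphism onto its image (equivalently, bounded below on `Y`) only when `Y` is
finite-dimensional. -/
def IsStrictlySingular {X Z : Type*} [NormedAddCommGroup X] [NormedSpace ℝ X]
    [NormedAddCommGroup Z] [NormedSpace ℝ Z] (S : X →L[ℝ] Z) : Prop :=
  ∀ Y : Submodule ℝ X, IsClosed (Y : Set X) →
    (∃ c : ℝ, 0 < c ∧ ∀ y ∈ Y, c * ‖y‖ ≤ ‖S y‖) → FiniteDimensional ℝ Y

/-- The `λ Id + S`-property of a real normed space: every bounded operator on it is the sum of a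
scalar multiple of the identity and a strictly singular operator. -/
def HasLambdaIdPlusSProperty (X : Type*) [NormedAddCommGroup X] [NormedSpace ℝ X] : Prop :=
  ∀ T : X →L[ℝ] X, ∃ (a : ℝ) (S : X →L[ℝ] X),
    IsStrictlySingular S ∧ T = a • ContinuousLinearMap.id ℝ X + S

/-! Write `T = a • 1 + S` with `S` strictly singular. When `X` is infinite-dimensional, `S` is
arbitrarily small on suitable infinite-dimensional subspaces, where `T` is almost `a • 1`; since `T`
is isometric, `|a| = 1`. Replacing `T` by `-T` if necessary, take `a = 1`; it remains to show that
`S = T - 1` is compact.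

Compactness is the vanishing of an induced operator. On bounded functions from the unit ball, given
the discrete topology, to the complexification, modulo limits of finite-valued functions, `T`
induces a contraction `R` and `S` induces `R - 1`. If `R = 1`, then `S` maps the ball to a totally
bounded set.

For every complex `w`, `1 - w • S` is bounded below up to finitely many functionals
(`IsStrictlySingular.exists_norm_le_extend`). The quotient absorbs finite-dimensional terms
(`norm_le_essentialMap_apply`), so `1 - w • (R - 1)` is bounded below, and connectedness of the
plane makes it invertible for all `w`. Thus `R` has no spectrum other than `1`, while its powers are
uniformly bounded above and below. Gelfand's theorem (`eq_one_of_powers_bounded`) forces `R = 1`. -/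

/-! ### Gelfand's theorem for doubly power bounded operators. -/

section Gelfand

variable {F : Type*} [NormedAddCommGroup F] [NormedSpace ℂ F]

/-- Resolvent estimate off the unit circle for an operator whose powers are uniformly bounded above
and below. -/
theorem abs_norm_sub_norm_mul_le {R : F →L[ℂ] F} (h1 : ∀ x, ‖R x‖ ≤ ‖x‖)
    (h2 : ∀ (n : ℕ) x, ‖x‖ ≤ 2 * ‖(R ^ n) x‖) (a b : ℂ) (x : F) :
    |‖a‖ - ‖b‖| * ‖x‖ ≤ 2 * ‖a • x - b • R x‖ := by
  rcases le_or_gt ‖b‖ ‖a‖ with hab | hab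
  · rw [abs_of_nonneg (sub_nonneg.2 hab)]
    have h := norm_sub_norm_le (a • x) (b • R x)
    rw [norm_smul, norm_smul] at h
    have := mul_le_mul_of_nonneg_left (h1 x) (norm_nonneg b)
    nlinarith [norm_nonneg (a • x - b • R x)]
  · rw [abs_of_neg (sub_neg.2 hab)]
    set y := a • x - b • R x with hy
    have hb : 0 < ‖b‖ := (norm_nonneg a).trans_lt hab
    have hd : 0 < ‖b‖ - ‖a‖ := sub_pos.2 hab
    have hpow : ∀ (n : ℕ) z, ‖(R ^ n) z‖ ≤ ‖z‖ := by
      intro n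
      induction n with
      | zero => intro z; simp
      | succ n ih => intro z; rw [pow_succ]; exact (ih (R z)).trans (h1 z)
    -- Iterating `b • R x = a • x - y` needs no inverse of `R`. The first term dies as `n` grows,
    -- and the lower bound on powers turns the rest into a bound on `‖x‖`.
    have key : ∀ n : ℕ, ‖(R ^ n) x‖ ≤ (‖a‖ / ‖b‖) ^ n * ‖x‖ + ‖y‖ / (‖b‖ - ‖a‖) := by
      intro n
      induction n with
      | zero => simpa using div_nonneg (norm_nonneg y) hd.le
      | succ n ih =>
        have e : b • (R ^ (n + 1)) x = a • (R ^ n) x - (R ^ n) y := by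
          rw [hy, map_sub, map_smul, map_smul, pow_succ]
          simp
        have h3 : ‖b‖ * ‖(R ^ (n + 1)) x‖ ≤ ‖a‖ * ‖(R ^ n) x‖ + ‖y‖ := by
          rw [← norm_smul, e]
          refine (norm_sub_le _ _).trans ?_
          rw [norm_smul]
          gcongr
          exact hpow n y
        have h4 := h3.trans (add_le_add_left (mul_le_mul_of_nonneg_left ih (norm_nonneg a)) _)
        rw [← mul_le_mul_iff_right₀ hb]
        refine h4.trans (le_of_eq ?_)
        rw [pow_succ]
        field_simp
        ring
    have hlim : Filter.Tendsto
        (fun n : ℕ => 2 * ((‖a‖ / ‖b‖) ^ n * ‖x‖ + ‖y‖ / (‖b‖ - ‖a‖))) Filter.atTop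
        (nhds (2 * (0 * ‖x‖ + ‖y‖ / (‖b‖ - ‖a‖)))) :=
      (((tendsto_pow_atTop_nhds_zero_of_lt_one (by positivity)
        ((div_lt_one hb).2 hab)).mul_const _).add_const _).const_mul _
    have h5 : ‖x‖ ≤ 2 * (0 * ‖x‖ + ‖y‖ / (‖b‖ - ‖a‖)) :=
      ge_of_tendsto' hlim fun n => (h2 n x).trans (by gcongr; exact key n)
    rw [zero_mul, zero_add, mul_div_assoc', le_div_iff₀ hd] at h5
    linarith

theorem norm_ringInverse_le {A : F →L[ℂ] F} (hA : IsUnit A) {c : ℝ} (hc : 0 ≤ c)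
    (h : ∀ x, ‖x‖ ≤ c * ‖A x‖) : ‖Ring.inverse A‖ ≤ c := by
  refine ContinuousLinearMap.opNorm_le_bound _ hc fun y => ?_
  have e : A (Ring.inverse A y) = y := by
    exact DFunLike.congr_fun (Ring.mul_inverse_cancel _ hA) y
  simpa [e] using h (Ring.inverse A y)

variable [CompleteSpace F]

/-- A bounded below operator which is a limit of invertible operators is invertible. -/
theorem isUnit_of_mem_closure {A : F →L[ℂ] F} {c : ℝ} (h : ∀ x, ‖x‖ ≤ c * ‖A x‖)
    (hA : A ∈ closure {B : F →L[ℂ] F | IsUnit B}) : IsUnit A := by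
  set k : ℝ := max c 1
  have hk : 0 < k := lt_max_of_lt_right one_pos
  have h' : ∀ x, ‖x‖ ≤ k * ‖A x‖ := fun x =>
    (h x).trans (mul_le_mul_of_nonneg_right (le_max_left _ _) (norm_nonneg _))
  obtain ⟨B, hB, hAB⟩ := Metric.mem_closure_iff.1 hA (1 / (4 * k)) (by positivity)
  rw [dist_eq_norm] at hAB
  have hBx : ∀ x, ‖x‖ ≤ (2 * k) * ‖B x‖ := by
    intro x
    have h1 : ‖A x‖ ≤ ‖B x‖ + 1 / (4 * k) * ‖x‖ := by
      have : A x = B x + (A - B) x := by simp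
      rw [this]
      refine (norm_add_le _ _).trans ?_
      gcongr
      exact (A - B).le_of_opNorm_le hAB.le x
    have h2 := (h' x).trans (mul_le_mul_of_nonneg_left h1 hk.le)
    have h3 : k * (‖B x‖ + 1 / (4 * k) * ‖x‖) = k * ‖B x‖ + ‖x‖ / 4 := by
      field_simp
    rw [h3] at h2
    linarith [norm_nonneg x]
  obtain ⟨u, rfl⟩ := hB
  have hu : ‖(↑u⁻¹ : F →L[ℂ] F)‖ ≤ 2 * k := by
    have := norm_ringInverse_le u.isUnit (by positivity) hBx
    rwa [Ring.inverse_unit] at this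
  have e : A = u * (1 - (↑u⁻¹ : F →L[ℂ] F) * (u - A)) := by
    rw [mul_sub, ← mul_assoc]; simp
  rw [e]
  refine u.isUnit.mul (isUnit_one_sub_of_norm_lt_one ?_)
  refine (norm_mul_le _ _).trans_lt ?_
  rw [norm_sub_rev] at hAB
  calc _ ≤ 2 * k * (1 / (4 * k)) := by gcongr
    _ < 1 := by field_simp; norm_num

/-- If `1 - w • N` is bounded below for every `w`, it is invertible for every `w`. -/
theorem isUnit_one_sub_smul {N : F →L[ℂ] F}
    (h : ∀ w : ℂ, ∃ c : ℝ, ∀ x, ‖x‖ ≤ c * ‖(1 - w • N) x‖) (w : ℂ) : IsUnit (1 - w • N) := by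
  have hcont : Continuous fun w : ℂ => 1 - w • N := by fun_prop
  -- Invertibility is an open condition; the lower bounds make it closed too, and it holds at `w =
  -- 0`.
  have hclopen : IsClopen {w : ℂ | IsUnit (1 - w • N)} := by
    refine ⟨?_, Units.isOpen.preimage hcont⟩
    rw [← closure_subset_iff_isClosed]
    intro w hw
    obtain ⟨c, hc⟩ := h w
    exact isUnit_of_mem_closure hc
      (map_mem_closure (f := fun w : ℂ => 1 - w • N) hcont hw fun v hv => hv)
  have hw : w ∈ {w : ℂ | IsUnit (1 - w • N)} := by
    rw [hclopen.eq_univ ⟨0, by simp⟩]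
    trivial
  exact hw

/-- A form of Gelfand's theorem: a doubly power bounded operator with spectrum `{1}` is the
identity. -/
theorem eq_one_of_powers_bounded {R : F →L[ℂ] F} (h1 : ∀ x, ‖R x‖ ≤ ‖x‖)
    (h2 : ∀ (n : ℕ) x, ‖x‖ ≤ 2 * ‖(R ^ n) x‖)
    (h : ∀ w : ℂ, ∃ c : ℝ, ∀ x, ‖x‖ ≤ c * ‖(1 - w • (R - 1)) x‖) : R = 1 := by
  have hu := isUnit_one_sub_smul h
  -- With the shift by `1 / 2` the operator inverted is `(u + 1/2) - (u - 1/2) R`. The two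
  -- coefficients have equal modulus only on the imaginary axis, so the resolvent estimate
  -- degenerates only there.
  set G : ℂ → (F →L[ℂ] F) := fun w => Ring.inverse (1 - (w - 1 / 2) • (R - 1)) with hG
  have hdiff : Differentiable ℂ G := by
    intro w
    have h3 : DifferentiableAt ℂ (fun w : ℂ => 1 - (w - 1 / 2) • (R - 1)) w := by fun_prop
    exact (differentiableAt_inverse (𝕜 := ℂ) (hu (w - 1 / 2))).comp w h3
  have hbound : ∀ u : ℂ, |u.re| * ‖G u‖ ≤ 2 * ‖u‖ + 1 := by
    intro u
    rcases eq_or_ne u.re 0 with h0 | h0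
    · rw [h0]; simp; positivity
    have hre : 0 < |u.re| := abs_pos.2 h0
    rw [mul_comm, ← le_div_iff₀ hre]
    refine norm_ringInverse_le (hu _) (by positivity) fun x => ?_
    have h4 := abs_norm_sub_norm_mul_le h1 h2 (u + 1 / 2) (u - 1 / 2) x
    have e : (1 - (u - 1 / 2) • (R - 1)) x = (u + 1 / 2) • x - (u - 1 / 2) • R x := by
      simp [smul_sub, sub_smul, add_smul]
      module
    rw [e]
    set p := ‖u + 1 / 2‖
    set q := ‖u - 1 / 2‖
    have hpq : p ^ 2 - q ^ 2 = 2 * u.re := by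
      simp only [p, q, ← Complex.normSq_eq_norm_sq, Complex.normSq_apply]
      simp
      ring
    have hp : p ≤ ‖u‖ + 1 / 2 := (norm_add_le _ _).trans (by norm_num)
    have hq : q ≤ ‖u‖ + 1 / 2 := (norm_sub_le _ _).trans (by norm_num)
    have h5 : 2 * |u.re| = |p - q| * (p + q) := by
      rw [← abs_of_nonneg (add_nonneg (norm_nonneg (u + 1 / 2)) (norm_nonneg (u - 1 / 2))),
        ← abs_mul, ← abs_two, ← abs_mul, ← hpq]
      congr 1
      ring
    rw [div_mul_eq_mul_div, le_div_iff₀ hre]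
    have h6 : |p - q| * (p + q) ≤ |p - q| * (2 * ‖u‖ + 1) :=
      mul_le_mul_of_nonneg_left (by linarith) (abs_nonneg _)
    have h7 : |p - q| * (2 * ‖u‖ + 1) * ‖x‖ ≤
        (2 * ‖u‖ + 1) * (2 * ‖(u + 1 / 2) • x - (u - 1 / 2) • R x‖) := by
      rw [mul_comm |p - q|, mul_assoc]; gcongr
    have h8 := mul_le_mul_of_nonneg_right (h5.le.trans h6) (norm_nonneg x)
    linarith
  have hbdd : ∀ u : ℂ, ‖G u‖ ≤ 9 := by
    intro u
    set r : ℝ := 2 * ‖u‖ + 1 with hr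
    have hr0 : 0 < r := by positivity
    -- On the circle of radius `r` the factor has modulus `2 * r * |v.re|`, which cancels the
    -- blow-up of `hbound` at the imaginary axis. The maximum principle carries the bound inside; as
    -- `‖u‖ ≤ r / 2`, the factor is at least `3 / 4 * r ^ 2` at `u`.
    have hmax : ‖(u ^ 2 + (r : ℂ) ^ 2) • G u‖ ≤ 2 * r * (2 * r + 1) := by
      refine Complex.norm_le_of_forall_mem_frontier_norm_le
        (f := fun u => (u ^ 2 + (r : ℂ) ^ 2) • G u) (U := Metric.ball 0 r)
        Metric.isBounded_ball ?_ ?_ (subset_closure ?_)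
      · refine Differentiable.diffContOnCl ?_
        fun_prop
      · intro v hv
        rw [frontier_ball _ hr0.ne', mem_sphere_zero_iff_norm] at hv
        have e : v ^ 2 + (r : ℂ) ^ 2 = v * (2 * v.re : ℝ) := by
          have := Complex.mul_conj' v
          rw [hv] at this
          rw [← this, ← Complex.add_conj]
          ring
        rw [norm_smul, e, norm_mul, hv, Complex.norm_real, Real.norm_eq_abs, abs_mul, abs_two]
        have := hbound v
        rw [hv] at this
        calc r * (2 * |v.re|) * ‖G v‖ = 2 * r * (|v.re| * ‖G v‖) := by ring
          _ ≤ _ := by gcongr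
      · rw [mem_ball_zero_iff]; linarith [norm_nonneg u]
    have hlow : 3 / 4 * r ^ 2 ≤ ‖u ^ 2 + (r : ℂ) ^ 2‖ := by
      have h3 := norm_sub_norm_le ((r : ℂ) ^ 2) (-(u ^ 2))
      rw [sub_neg_eq_add, norm_neg, norm_pow, norm_pow, Complex.norm_real, Real.norm_eq_abs,
        abs_of_pos hr0, add_comm] at h3
      nlinarith [norm_nonneg u]
    rw [norm_smul] at hmax
    have h4 := (mul_le_mul_of_nonneg_right hlow (norm_nonneg (G u))).trans hmax
    have hr1 : 1 ≤ r := by linarith [norm_nonneg u]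
    by_contra! hcon
    have h5 : 3 / 4 * r ^ 2 * 9 ≤ 3 / 4 * r ^ 2 * ‖G u‖ := by gcongr
    nlinarith
  -- Liouville: the values at `3 / 2` and `1 / 2` are the inverses of `1 - (R - 1)` and of `1`.
  have hconst := hdiff.apply_eq_apply_of_bounded
    (isBounded_iff_forall_norm_le.2 ⟨9, by rintro _ ⟨u, rfl⟩; exact hbdd u⟩) (3 / 2) (1 / 2)
  have e1 : (1 - ((3 / 2 : ℂ) - 1 / 2) • (R - 1)) = 1 - (R - 1) := by norm_num
  have e2 : (1 - ((1 / 2 : ℂ) - 1 / 2) • (R - 1)) = 1 := by simp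
  have hu1 : IsUnit (1 - (R - 1)) := by simpa using hu 1
  simp only [hG, e1, e2, Ring.inverse_one] at hconst
  have := Ring.mul_inverse_cancel _ hu1
  rw [hconst, mul_one, sub_eq_self, sub_eq_zero] at this
  exact this

end Gelfand

open scoped BoundedContinuousFunction

/-! ### The quotient that detects compactness. -/

section FiniteRangeQuotient

variable {ι : Type*} [TopologicalSpace ι]
  {V : Type*} [NormedAddCommGroup V] [NormedSpace ℂ V]

variable (ι V) in
/-- The bounded functions taking finitely many values. -/
noncomputable def finiteRangeFunctions : Submodule ℂ (ι →ᵇ V) where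
  carrier := {f | (Set.range f).Finite}
  zero_mem' := (Set.finite_singleton (0 : V)).subset (by rintro _ ⟨i, rfl⟩; simp)
  add_mem' {f g} hf hg := (hf.add hg).subset (by
    rintro _ ⟨i, rfl⟩
    exact Set.add_mem_add ⟨i, rfl⟩ ⟨i, rfl⟩)
  smul_mem' c f hf := (hf.image (c • ·)).subset (by
    rintro _ ⟨i, rfl⟩
    exact ⟨f i, ⟨i, rfl⟩, rfl⟩)

variable (ι V) in
/-- The bounded functions approximable by functions taking finitely many values. -/
noncomputable abbrev almostFiniteRange : Submodule ℂ (ι →ᵇ V) := (finiteRangeFunctions ι V).topologicalClosure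

instance : IsClosed (almostFiniteRange ι V : Set (ι →ᵇ V)) :=
  (finiteRangeFunctions ι V).isClosed_topologicalClosure

variable (ι V) in
/-- Bounded functions modulo those of totally bounded range. -/
noncomputable abbrev EssentialSpace : Type _ := (ι →ᵇ V) ⧸ almostFiniteRange ι V

theorem EssentialSpace.norm_mk (f : ι →ᵇ V) :
    ‖(Submodule.Quotient.mk f : EssentialSpace ι V)‖ =
      Metric.infDist f (finiteRangeFunctions ι V : Set (ι →ᵇ V)) :=
  (QuotientAddGroup.norm_mk (S := (almostFiniteRange ι V).toAddSubgroup) f).trans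
    Metric.infDist_closure

theorem EssentialSpace.norm_mk_lt_iff {f : ι →ᵇ V} {r : ℝ} :
    ‖(Submodule.Quotient.mk f : EssentialSpace ι V)‖ < r ↔
      ∃ m : ι →ᵇ V, (Set.range m).Finite ∧ ‖f - m‖ < r := by
  rw [norm_mk, Metric.infDist_lt_iff ⟨0, (finiteRangeFunctions ι V).zero_mem⟩]
  simp only [dist_eq_norm]
  rfl

theorem almostFiniteRange_le_ker (A : V →L[ℂ] V) :
    almostFiniteRange ι V ≤
      ((almostFiniteRange ι V).mkQL ∘L A.compLeftContinuousBounded ι).ker := by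
  refine Submodule.topologicalClosure_minimal _ ?_ (ContinuousLinearMap.isClosed_ker _)
  intro f hf
  rw [LinearMap.mem_ker]
  refine (Submodule.Quotient.mk_eq_zero _).2 (Submodule.le_topologicalClosure _ ?_)
  refine (Set.Finite.image A hf).subset ?_
  rintro _ ⟨i, rfl⟩
  exact ⟨f i, ⟨i, rfl⟩, rfl⟩

variable (ι) in
/-- The operator induced on the essential space. -/
noncomputable def essentialMap (A : V →L[ℂ] V) : EssentialSpace ι V →L[ℂ] EssentialSpace ι V :=
  (almostFiniteRange ι V).liftQL _ (almostFiniteRange_le_ker A)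

theorem essentialMap_mk (A : V →L[ℂ] V) (f : ι →ᵇ V) :
    essentialMap ι A (Submodule.Quotient.mk f) =
      Submodule.Quotient.mk (A.compLeftContinuousBounded ι f) := rfl

theorem essentialMap_one : essentialMap ι (1 : V →L[ℂ] V) = 1 := by
  ext e
  induction e using Submodule.Quotient.induction_on with | _ f
  rfl

theorem essentialMap_mul (A B : V →L[ℂ] V) :
    essentialMap ι (A * B) = essentialMap ι A * essentialMap ι B := by
  ext e
  induction e using Submodule.Quotient.induction_on with | _ f
  rfl

theorem essentialMap_pow (A : V →L[ℂ] V) (n : ℕ) :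
    essentialMap ι (A ^ n) = essentialMap ι A ^ n := by
  induction n with
  | zero => simp [essentialMap_one]
  | succ n ih => rw [pow_succ, pow_succ, essentialMap_mul, ih]

theorem essentialMap_sub (A B : V →L[ℂ] V) :
    essentialMap ι (A - B) = essentialMap ι A - essentialMap ι B := by
  ext e
  induction e using Submodule.Quotient.induction_on with | _ f
  rfl

theorem essentialMap_one_sub_smul (A : V →L[ℂ] V) (w : ℂ) :
    essentialMap ι (1 - w • (A - 1)) = 1 - w • (essentialMap ι A - 1) := by
  ext e
  induction e using Submodule.Quotient.induction_on with | _ f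
  rfl

theorem norm_essentialMap_apply_le {A : V →L[ℂ] V} (hA : ∀ v, ‖A v‖ ≤ ‖v‖)
    (e : EssentialSpace ι V) : ‖essentialMap ι A e‖ ≤ ‖e‖ := by
  induction e using Submodule.Quotient.induction_on with | _ f
  refine le_of_forall_gt fun r hr => ?_
  obtain ⟨m, hm, hfm⟩ := EssentialSpace.norm_mk_lt_iff.1 hr
  rw [essentialMap_mk, EssentialSpace.norm_mk_lt_iff]
  refine ⟨A.compLeftContinuousBounded ι m, (hm.image A).subset ?_, lt_of_le_of_lt ?_ hfm⟩
  · rintro _ ⟨i, rfl⟩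
    exact ⟨m i, ⟨i, rfl⟩, rfl⟩
  · rw [← map_sub]
    refine (BoundedContinuousFunction.norm_le (norm_nonneg _)).2 fun i => ?_
    exact (hA _).trans ((f - m).norm_coe_le_norm i)

theorem totallyBounded_range_of_mk_eq_zero {f : ι →ᵇ V}
    (hf : (Submodule.Quotient.mk f : EssentialSpace ι V) = 0) :
    TotallyBounded (Set.range f) := by
  refine Metric.totallyBounded_iff.2 fun ε hε => ?_
  have : ‖(Submodule.Quotient.mk f : EssentialSpace ι V)‖ < ε := by rwa [hf, norm_zero]
  obtain ⟨m, hm, hfm⟩ := EssentialSpace.norm_mk_lt_iff.1 this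
  refine ⟨Set.range m, hm, ?_⟩
  rintro _ ⟨i, rfl⟩
  simp only [Set.mem_iUnion]
  refine ⟨m i, ⟨i, rfl⟩, ?_⟩
  rw [Metric.mem_ball, dist_eq_norm]
  exact ((f - m).norm_coe_le_norm i).trans_lt hfm

variable [DiscreteTopology ι]

/-- An operator which is bounded below up to a finite-dimensional term is bounded below on the
essential space. -/
theorem norm_le_essentialMap_apply {W : Type*} [NormedAddCommGroup W] [NormedSpace ℝ W]
    [FiniteDimensional ℝ W] (Φ : V →L[ℝ] W) {A : V →L[ℂ] V} {C D : ℝ} (hC : 0 ≤ C) (hD : 0 ≤ D)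
    (h : ∀ v, ‖v‖ ≤ C * ‖A v‖ + D * ‖Φ v‖) (e : EssentialSpace ι V) :
    ‖e‖ ≤ 2 * C * ‖essentialMap ι A e‖ := by
  induction e using Submodule.Quotient.induction_on with | _ f
  have key : ∀ r > ‖essentialMap ι A (Submodule.Quotient.mk f)‖, ∀ δ > 0,
      ‖(Submodule.Quotient.mk f : EssentialSpace ι V)‖ ≤ C * (2 * r) + D * (2 * δ) := by
    intro r hr δ hδ
    rw [gt_iff_lt, essentialMap_mk, EssentialSpace.norm_mk_lt_iff] at hr
    obtain ⟨m, hm, hfm⟩ := hr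
    have hΦ : TotallyBounded (Set.range fun i => Φ (f i)) := by
      have hb : Bornology.IsBounded (Set.range fun i => Φ (f i)) := by
        refine isBounded_iff_forall_norm_le.2 ⟨‖Φ‖ * ‖f‖, ?_⟩
        rintro _ ⟨i, rfl⟩
        exact Φ.le_opNorm_of_le (f.norm_coe_le_norm i)
      have := FiniteDimensional.proper ℝ W
      exact hb.isCompact_closure.totallyBounded.subset subset_closure
    obtain ⟨t, ht, hcov⟩ := Metric.totallyBounded_iff.1 hΦ δ hδ
    have : ∀ i, ∃ c ∈ t, dist (Φ (f i)) c < δ := fun i => by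
      simpa using hcov ⟨i, rfl⟩
    choose c hct hc using this
    -- The finitely many values of `q` partition `ι`. Within a class, `A ∘ f` varies by at most `2 *
    -- r` and `Φ ∘ f` by at most `2 * δ`, so `f` is close to the finite-valued `g` that is constant
    -- on classes.
    set q : ι → V × W := fun i => (m i, c i)
    have hq : (Set.range q).Finite := (hm.prod ht).subset (by
      rintro _ ⟨i, rfl⟩
      exact ⟨⟨i, rfl⟩, hct i⟩)
    set rep : ι → ι := fun i => Set.rangeSplitting q ⟨q i, i, rfl⟩
    have hrep : ∀ i, q (rep i) = q i := fun i => Set.apply_rangeSplitting q _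
    set g : ι →ᵇ V := BoundedContinuousFunction.ofNormedAddCommGroupDiscrete
      (fun i => f (rep i)) ‖f‖ (fun i => f.norm_coe_le_norm _)
    have hg : (Set.range g).Finite := by
      have := hq.to_subtype
      refine (Set.finite_range fun z : Set.range q => f (Set.rangeSplitting q z)).subset ?_
      rintro _ ⟨i, rfl⟩
      exact ⟨⟨q i, i, rfl⟩, rfl⟩
    have hr0 : 0 ≤ r := (norm_nonneg _).trans hfm.le
    have hfg : ‖f - g‖ ≤ C * (2 * r) + D * (2 * δ) := by
      refine (BoundedContinuousFunction.norm_le (by positivity)).2 fun i => ?_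
      refine (h _).trans ?_
      have hAm : ∀ j, ‖A (f j) - m j‖ ≤ r := fun j =>
        ((A.compLeftContinuousBounded ι f - m).norm_coe_le_norm j).trans hfm.le
      have hm' : m (rep i) = m i := congrArg Prod.fst (hrep i)
      have hc' : c (rep i) = c i := congrArg Prod.snd (hrep i)
      change C * ‖A (f i - f (rep i))‖ + D * ‖Φ (f i - f (rep i))‖ ≤ _
      gcongr
      · have e : A (f i - f (rep i)) = (A (f i) - m i) - (A (f (rep i)) - m (rep i)) := by
          rw [hm', map_sub]; abel
        rw [e, two_mul]
        exact (norm_sub_le _ _).trans (add_le_add (hAm _) (hAm _))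
      · rw [map_sub, ← dist_eq_norm, two_mul]
        refine (dist_triangle_right _ _ (c i)).trans (add_le_add (hc i).le ?_)
        rw [← hc']
        exact (hc _).le
    rw [EssentialSpace.norm_mk]
    exact (Metric.infDist_le_dist_of_mem
      (s := (finiteRangeFunctions ι V : Set (ι →ᵇ V))) hg).trans (by rwa [dist_eq_norm])
  have hlim : ∀ ε > 0, ‖(Submodule.Quotient.mk f : EssentialSpace ι V)‖ ≤
      2 * C * ‖essentialMap ι A (Submodule.Quotient.mk f)‖ + (2 * C + 2 * D) * ε := by
    intro ε hε
    refine (key _ (lt_add_of_pos_right _ hε) ε hε).trans (le_of_eq ?_)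
    ring
  refine le_of_forall_pos_le_add fun ε hε => ?_
  refine (hlim (ε / (2 * C + 2 * D + 1)) (by positivity)).trans ?_
  gcongr
  rw [mul_div_assoc', div_le_iff₀ (by positivity)]
  nlinarith

end FiniteRangeQuotient

/-! ### Strictly singular operators and finite-codimensional lower bounds. -/

section StrictlySingular

variable {V : Type*} [NormedAddCommGroup V] [NormedSpace ℝ V]
  {W : Type*} [NormedAddCommGroup W] [NormedSpace ℝ W]

/-- An operator which is not bounded below on the common kernel of any finite family of functionals
is arbitrarily small on some infinite-dimensional subspace. -/
theorem exists_infinite_dim_small (U : V →L[ℝ] W)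
    (hU : ∀ (F : Finset (V →L[ℝ] ℝ)) (ε : ℝ), 0 < ε →
      ∃ y : V, y ≠ 0 ∧ (∀ f ∈ F, f y = 0) ∧ ‖U y‖ < ε * ‖y‖)
    {ε : ℝ} (hε : 0 < ε) :
    ∃ Z : Submodule ℝ V, ¬ FiniteDimensional ℝ Z ∧ ∀ z ∈ Z, ‖U z‖ ≤ ε * ‖z‖ := by
  classical
  have step : ∀ (F : Finset (V →L[ℝ] ℝ)) (δ : ℝ), ∃ p : V × (V →L[ℝ] ℝ), 0 < δ →
      (∀ f ∈ F, f p.1 = 0) ∧ ‖U p.1‖ ≤ δ ∧ p.2 p.1 = 1 ∧ ‖p.2‖ ≤ 1 ∧ ‖p.1‖ ≤ 1 := by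
    intro F δ
    by_cases hδ : 0 < δ
    · obtain ⟨y, hy, hF, hUy⟩ := hU F δ hδ
      obtain ⟨g, hg1, hg2⟩ := exists_dual_vector ℝ y (norm_ne_zero_iff.2 hy)
      have hy' : 0 < ‖y‖ := norm_pos_iff.2 hy
      refine ⟨(‖y‖⁻¹ • y, g), fun _ => ⟨fun f hf => ?_, ?_, ?_, hg1.le, ?_⟩⟩
      · simp [hF f hf]
      · simp only [map_smul, norm_smul, norm_inv, norm_norm]
        rw [inv_mul_le_iff₀ hy', mul_comm]
        exact hUy.le
      · simp only [map_smul, hg2, smul_eq_mul]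
        exact inv_mul_cancel₀ hy'.ne'
      · rw [norm_smul, norm_inv, norm_norm, inv_mul_cancel₀ hy'.ne']
    · exact ⟨0, fun h => absurd h hδ⟩
  choose P hP using step
  -- The decay `4 ^ n` beats the growth `2 ^ n` of the coefficients in `hcoeff`, leaving a geometric
  -- series with sum at most `2`.
  set δ : ℕ → ℝ := fun n => ε / 2 / 4 ^ n
  have hδ : ∀ n, 0 < δ n := fun n => by positivity
  let s : ℕ → Finset (V →L[ℝ] ℝ) := fun n =>
    Nat.rec ∅ (fun n F => insert (P F (δ n)).2 F) n
  have hs : ∀ n, s (n + 1) = insert (P (s n) (δ n)).2 (s n) := fun n => rfl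
  set y : ℕ → V := fun n => (P (s n) (δ n)).1
  set g : ℕ → (V →L[ℝ] ℝ) := fun n => (P (s n) (δ n)).2
  have hmono : ∀ m n, m < n → g m ∈ s n := by
    intro m n hmn
    induction n with
    | zero => omega
    | succ n ih =>
      rw [hs]
      rcases Nat.lt_succ_iff_lt_or_eq.1 hmn with h | rfl
      · exact Finset.mem_insert_of_mem (ih h)
      · exact Finset.mem_insert_self _ _
  have hzero : ∀ m n, m < n → g m (y n) = 0 := fun m n hmn =>
    (hP (s n) (δ n) (hδ n)).1 _ (hmono m n hmn)
  have hUy : ∀ n, ‖U (y n)‖ ≤ δ n := fun n => (hP (s n) (δ n) (hδ n)).2.1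
  have hone : ∀ n, g n (y n) = 1 := fun n => (hP (s n) (δ n) (hδ n)).2.2.1
  have hgn : ∀ n, ‖g n‖ ≤ 1 := fun n => (hP (s n) (δ n) (hδ n)).2.2.2.1
  have hgle : ∀ n z, |g n z| ≤ ‖z‖ := fun n z => by
    simpa using (g n).le_of_opNorm_le (hgn n) z
  have hgy : ∀ m n, |g m (y n)| ≤ 1 := fun m n =>
    (hgle m (y n)).trans (hP (s n) (δ n) (hδ n)).2.2.2.2
  -- The matrix `g m (y n)` is triangular with unit diagonal and entries at most `1`, so
  -- coefficients are recovered by back substitution, at worst doubling the bound at each stage.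
  have hcoeff : ∀ (l : ℕ →₀ ℝ) (n : ℕ), |l n| ≤ 2 ^ n * ‖Finsupp.linearCombination ℝ y l‖ := by
    intro l n
    set z := Finsupp.linearCombination ℝ y l with hz
    induction n using Nat.strong_induction_on with | _ n ih
    have e : g n z = ∑ k ∈ Finset.range n, l k * g n (y k) + l n := by
      have e1 : g n z = ∑ k ∈ l.support ∪ Finset.range (n + 1), l k * g n (y k) := by
        rw [hz, Finsupp.linearCombination_apply,
          Finsupp.sum_of_support_subset l
            (Finset.subset_union_left (s₂ := Finset.range (n + 1))) _ (by simp), map_sum]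
        simp
      have e2 : ∑ k ∈ Finset.range (n + 1), l k * g n (y k) =
          ∑ k ∈ l.support ∪ Finset.range (n + 1), l k * g n (y k) := by
        refine Finset.sum_subset Finset.subset_union_right fun k _ hk => ?_
        rw [Finset.mem_range] at hk
        rw [hzero n k (by omega), mul_zero]
      rw [e1, ← e2, Finset.sum_range_succ, hone, mul_one]
    have e2 : |∑ k ∈ Finset.range n, l k * g n (y k)| ≤ (2 ^ n - 1) * ‖z‖ := by
      have h2 : ∑ k ∈ Finset.range n, (2 : ℝ) ^ k = 2 ^ n - 1 := by
        rw [geom_sum_eq (by norm_num)]; norm_num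
      rw [← h2, Finset.sum_mul]
      refine (Finset.abs_sum_le_sum_abs _ _).trans (Finset.sum_le_sum fun k hk => ?_)
      rw [abs_mul]
      exact (mul_le_of_le_one_right (abs_nonneg _) (hgy n k)).trans (ih k (Finset.mem_range.1 hk))
    have e3 : l n = g n z - ∑ k ∈ Finset.range n, l k * g n (y k) := by rw [e]; ring
    rw [e3]
    refine (abs_sub _ _).trans ?_
    linarith [hgle n z]
  have hli : LinearIndependent ℝ y := by
    rw [linearIndependent_iff]
    intro l hl
    ext n
    have := hcoeff l n
    rw [hl, norm_zero, mul_zero] at this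
    simpa using this
  refine ⟨Submodule.span ℝ (Set.range y), fun hfin => ?_, fun z hz => ?_⟩
  · have := (linearIndependent_span hli).finite
    exact not_finite ℕ
  · obtain ⟨l, rfl⟩ := (Finsupp.mem_span_range_iff_exists_finsupp).1 hz
    have hl := hcoeff l
    rw [Finsupp.linearCombination_apply] at hl
    set z := l.sum fun i a => a • y i with hz
    obtain ⟨N, hN⟩ := l.support.exists_nat_subset_range
    have hgeom : ∑ k ∈ Finset.range N, (1 / 2 : ℝ) ^ k ≤ 2 := by
      exact sum_geometric_two_le N
    calc ‖U z‖ = ‖∑ k ∈ Finset.range N, l k • U (y k)‖ := by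
          rw [hz, Finsupp.sum_of_support_subset l hN _ (by simp), map_sum]
          simp
      _ ≤ ∑ k ∈ Finset.range N, ε / 2 * ‖z‖ * (1 / 2 : ℝ) ^ k := by
          refine (norm_sum_le _ _).trans (Finset.sum_le_sum fun k _ => ?_)
          rw [norm_smul, Real.norm_eq_abs]
          calc |l k| * ‖U (y k)‖ ≤ (2 ^ k * ‖z‖) * δ k :=
                mul_le_mul (hl k) (hUy k) (norm_nonneg _) (by positivity)
            _ = ε / 2 * ‖z‖ * (1 / 2 : ℝ) ^ k := by
                have : (4 : ℝ) ^ k = 2 ^ k * 2 ^ k := by rw [← mul_pow]; norm_num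
                simp only [δ, this, one_div, inv_pow]
                field_simp
      _ ≤ ε / 2 * ‖z‖ * 2 := by
          rw [← Finset.mul_sum]
          gcongr
      _ = ε * ‖z‖ := by ring

/-- An operator is either small on an infinite-dimensional subspace, or bounded below up to a
finite-dimensional term. -/
theorem exists_infinite_dim_small_or_bounded_below (U : V →L[ℝ] W) {ε : ℝ} (hε : 0 < ε) :
    (∃ Z : Submodule ℝ V, ¬ FiniteDimensional ℝ Z ∧ ∀ z ∈ Z, ‖U z‖ ≤ ε * ‖z‖) ∨
    ∃ (F : Finset (V →L[ℝ] ℝ)) (c : ℝ), 0 < c ∧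
      ∀ y : V, (∀ f ∈ F, f y = 0) → c * ‖y‖ ≤ ‖U y‖ := by
  by_cases h : ∀ (F : Finset (V →L[ℝ] ℝ)) (ε : ℝ), 0 < ε →
      ∃ y : V, y ≠ 0 ∧ (∀ f ∈ F, f y = 0) ∧ ‖U y‖ < ε * ‖y‖
  · exact Or.inl (exists_infinite_dim_small U h hε)
  · push Not at h
    obtain ⟨F, c, hc, h⟩ := h
    refine Or.inr ⟨F, c, hc, fun y hy => ?_⟩
    rcases eq_or_ne y 0 with rfl | hy0
    · simp
    · exact h y hy0 hy

/-- The evaluation of finitely many functionals. -/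
noncomputable def evalFunctionals (F : Finset (V →L[ℝ] ℝ)) : V →L[ℝ] (F → ℝ) :=
  ContinuousLinearMap.pi fun f => f.1

theorem evalFunctionals_eq_zero_iff {F : Finset (V →L[ℝ] ℝ)} {v : V} :
    evalFunctionals F v = 0 ↔ ∀ f ∈ F, f v = 0 := by
  simp [evalFunctionals, funext_iff]

/-- A linear section of the evaluation map on its finite-dimensional range is bounded; subtracting
its value moves `v` into the common kernel, where `U` is bounded below. -/
theorem exists_le_add_norm_evalFunctionals (U : V →L[ℝ] W) {F : Finset (V →L[ℝ] ℝ)} {c : ℝ}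
    (hc : 0 < c) (h : ∀ y : V, (∀ f ∈ F, f y = 0) → c * ‖y‖ ≤ ‖U y‖) :
    ∃ C D : ℝ, 0 ≤ C ∧ 0 ≤ D ∧ ∀ v, ‖v‖ ≤ C * ‖U v‖ + D * ‖evalFunctionals F v‖ := by
  set Φ := evalFunctionals F
  obtain ⟨s, hs⟩ := (Φ : V →ₗ[ℝ] (F → ℝ)).rangeRestrict.exists_rightInverse_of_surjective
    (LinearMap.range_rangeRestrict _)
  set σ : (Φ : V →ₗ[ℝ] (F → ℝ)).range →L[ℝ] V := LinearMap.toContinuousLinearMap s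
  have hσ : ∀ v, Φ (σ ⟨Φ v, v, rfl⟩) = Φ v := fun v =>
    congrArg Subtype.val (LinearMap.congr_fun hs ⟨Φ v, v, rfl⟩)
  refine ⟨c⁻¹, c⁻¹ * (‖U‖ * ‖σ‖) + ‖σ‖, by positivity, by positivity, fun v => ?_⟩
  set z := σ ⟨Φ v, v, rfl⟩
  have hz : ‖z‖ ≤ ‖σ‖ * ‖Φ v‖ := σ.le_opNorm _
  have h1 := h (v - z) (evalFunctionals_eq_zero_iff.1 (by
    rw [map_sub, sub_eq_zero]; exact (hσ v).symm))
  have h2 : ‖U (v - z)‖ ≤ ‖U v‖ + ‖U‖ * (‖σ‖ * ‖Φ v‖) := by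
    rw [map_sub]
    refine (norm_sub_le _ _).trans ?_
    gcongr
    exact U.le_opNorm_of_le hz
  have h3 : ‖v - z‖ ≤ c⁻¹ * (‖U v‖ + ‖U‖ * (‖σ‖ * ‖Φ v‖)) := by
    rw [← div_eq_inv_mul, le_div_iff₀ hc, mul_comm]
    exact h1.trans h2
  have h4 : ‖v‖ ≤ ‖v - z‖ + ‖z‖ := by
    simpa using norm_add_le (v - z) z
  calc ‖v‖ ≤ c⁻¹ * (‖U v‖ + ‖U‖ * (‖σ‖ * ‖Φ v‖)) + ‖σ‖ * ‖Φ v‖ := by linarith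
    _ = _ := by ring

variable {X : Type*} [NormedAddCommGroup X] [NormedSpace ℝ X]

/-- A strictly singular operator, composed with any operator on an infinite-dimensional space, is
small on some infinite-dimensional subspace. -/
theorem IsStrictlySingular.exists_infinite_dim_small {S : X →L[ℝ] W} (hS : IsStrictlySingular S)
    (hV : ¬ FiniteDimensional ℝ V) (P : V →L[ℝ] X) {ε : ℝ} (hε : 0 < ε) :
    ∃ Z : Submodule ℝ V, ¬ FiniteDimensional ℝ Z ∧ ∀ z ∈ Z, ‖S (P z)‖ ≤ ε * ‖z‖ := by
  refine (exists_infinite_dim_small_or_bounded_below (S ∘L P) hε).resolve_right ?_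
  rintro ⟨F, c, hc, h⟩
  set Φ : V →ₗ[ℝ] (F → ℝ) := (evalFunctionals F : V →ₗ[ℝ] (F → ℝ))
  have hker : ∀ y ∈ Φ.ker, c * ‖y‖ ≤ ‖S (P y)‖ := fun y hy =>
    h y (evalFunctionals_eq_zero_iff.1 hy)
  -- `P` need not be an embedding, but a lower bound for `S ∘ P` on `Φ.ker` makes `P` injective
  -- there and `S` bounded below on the image. Hence the image, `Φ.ker` and finally `V` are
  -- finite-dimensional.
  set Y : Submodule ℝ X := Φ.ker.map (P : V →ₗ[ℝ] X)
  set k := c / (‖P‖ + 1)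
  have hY : ∀ x ∈ Y.topologicalClosure, k * ‖x‖ ≤ ‖S x‖ := by
    have hcl : IsClosed {x : X | k * ‖x‖ ≤ ‖S x‖} :=
      isClosed_le (by fun_prop) (by fun_prop)
    refine fun x hx => closure_minimal ?_ hcl hx
    rintro _ ⟨y, hy, rfl⟩
    refine le_trans ?_ (hker y hy)
    have h1 : ‖P y‖ ≤ (‖P‖ + 1) * ‖y‖ :=
      (P.le_opNorm y).trans (by gcongr; linarith)
    calc k * ‖P y‖ ≤ k * ((‖P‖ + 1) * ‖y‖) := by gcongr
      _ = c * ‖y‖ := by simp only [k]; field_simp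
  have hfin := hS Y.topologicalClosure Y.isClosed_topologicalClosure ⟨k, by positivity, hY⟩
  have hYfin : FiniteDimensional ℝ Y :=
    Submodule.finiteDimensional_of_le Y.le_topologicalClosure
  have hinj : Function.Injective ((P : V →ₗ[ℝ] X).domRestrict Φ.ker) := by
    rw [injective_iff_map_eq_zero]
    rintro ⟨y, hy⟩ h0
    have h1 := hker y hy
    have h2 : P y = 0 := h0
    rw [h2, map_zero, norm_zero] at h1
    have : ‖y‖ = 0 := by nlinarith [norm_nonneg y]
    simpa using this
  have hkfin : FiniteDimensional ℝ Φ.ker := by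
    refine FiniteDimensional.of_injective
      (((P : V →ₗ[ℝ] X).domRestrict Φ.ker).codRestrict Y fun y => ⟨y.1, y.2, rfl⟩) ?_
    intro a b hab
    exact hinj (congrArg Subtype.val hab)
  have hqfin : FiniteDimensional ℝ (V ⧸ Φ.ker) :=
    Module.Finite.equiv Φ.quotKerEquivRange.symm
  exact hV (Module.Finite.of_submodule_quotient Φ.ker)

end StrictlySingular

/-! ### Complexification with the operator norm. -/

section Complexification

variable (X : Type*) [NormedAddCommGroup X] [NormedSpace ℝ X]

/-- The complexification of a real normed space, realised as the real-linear maps from `ℂ`. -/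
def NormedComplexification : Type _ := ℂ →L[ℝ] X

namespace NormedComplexification

noncomputable instance : NormedAddCommGroup (NormedComplexification X) :=
  inferInstanceAs (NormedAddCommGroup (ℂ →L[ℝ] X))

instance [CompleteSpace X] : CompleteSpace (NormedComplexification X) :=
  inferInstanceAs (CompleteSpace (ℂ →L[ℝ] X))

variable {X}

/-- The underlying real-linear map. -/
def toCLM (f : NormedComplexification X) : ℂ →L[ℝ] X := f

/-- The element with a given underlying real-linear map. -/
def ofCLM (f : ℂ →L[ℝ] X) : NormedComplexification X := f

@[ext]
theorem ext {f g : NormedComplexification X} (h : ∀ z, f.toCLM z = g.toCLM z) : f = g :=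
  ContinuousLinearMap.ext h

/-- Scalars act on the source, so the operator norm is a complex norm and postcomposition with a
real isometry remains isometric. -/
noncomputable instance : SMul ℂ (NormedComplexification X) where
  smul c f := ofCLM (f.toCLM ∘L ContinuousLinearMap.mul ℝ ℂ c)

theorem smul_toCLM (c : ℂ) (f : NormedComplexification X) (z : ℂ) :
    (c • f).toCLM z = f.toCLM (c * z) := rfl

theorem add_toCLM (f g : NormedComplexification X) (z : ℂ) :
    (f + g).toCLM z = f.toCLM z + g.toCLM z := rfl

theorem zero_toCLM (z : ℂ) : (0 : NormedComplexification X).toCLM z = 0 := rfl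

noncomputable instance : Module ℂ (NormedComplexification X) where
  one_smul f := by ext z; simp [smul_toCLM]
  mul_smul a b f := by ext z; simp only [smul_toCLM]; congr 1; ring
  smul_zero a := by ext z; simp [smul_toCLM, zero_toCLM]
  smul_add a f g := by ext z; simp [smul_toCLM, add_toCLM]
  add_smul a b f := by ext z; simp [smul_toCLM, add_toCLM, add_mul]
  zero_smul f := by ext z; simp [smul_toCLM, zero_toCLM]

noncomputable instance : NormedSpace ℂ (NormedComplexification X) where
  norm_smul_le c f := by
    refine (ContinuousLinearMap.opNorm_comp_le f.toCLM (ContinuousLinearMap.mul ℝ ℂ c)).trans ?_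
    rw [mul_comm]
    exact mul_le_mul_of_nonneg_right (ContinuousLinearMap.opNorm_mul_apply_le ℝ ℂ c)
      (norm_nonneg f)

/-- Evaluation at a complex number. -/
noncomputable def eval (z : ℂ) : NormedComplexification X →L[ℝ] X :=
  LinearMap.mkContinuous
    { toFun := fun f => f.toCLM z
      map_add' := fun f g => rfl
      map_smul' := fun r f => by
        change f.toCLM ((r : ℂ) * z) = _
        rw [← Complex.real_smul, map_smul]
        rfl } ‖z‖ fun f => by
    rw [mul_comm]
    exact f.toCLM.le_opNorm z

theorem eval_apply (z : ℂ) (f : NormedComplexification X) : eval z f = f.toCLM z := rfl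

theorem norm_le_norm_eval_add (f : NormedComplexification X) :
    ‖f‖ ≤ ‖eval 1 f‖ + ‖eval Complex.I f‖ := by
  refine ContinuousLinearMap.opNorm_le_bound f.toCLM (by positivity) fun z => ?_
  have e : f.toCLM z = z.re • f.toCLM 1 + z.im • f.toCLM Complex.I := by
    rw [← map_smul, ← map_smul, ← map_add]
    congr 1
    simp [Complex.re_add_im]
  rw [e, add_mul]
  refine (norm_add_le _ _).trans ?_
  rw [norm_smul, norm_smul, mul_comm, mul_comm ‖z.im‖, eval_apply, eval_apply]
  gcongr
  · exact Complex.abs_re_le_norm z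
  · exact Complex.abs_im_le_norm z

/-- The element of the complexification attached to a vector. -/
noncomputable def ofReal (x : X) : NormedComplexification X :=
  ofCLM (Complex.reCLM.smulRight x)

theorem eval_one_ofReal (x : X) : eval 1 (ofReal x) = x := by
  change (1 : ℂ).re • x = x
  simp

theorem norm_ofReal_le (x : X) : ‖ofReal x‖ ≤ ‖x‖ := by
  refine (norm_le_norm_eval_add _).trans ?_
  have : eval Complex.I (ofReal x) = 0 := by
    change Complex.I.re • x = 0
    simp
  rw [eval_one_ofReal, this, norm_zero, add_zero]

/-- The complex-linear extension of an operator. -/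
noncomputable def extend (A : X →L[ℝ] X) :
    NormedComplexification X →L[ℂ] NormedComplexification X :=
  LinearMap.mkContinuous
    { toFun := fun f => ofCLM (A ∘L f.toCLM)
      map_add' := fun f g => by ext z; exact map_add A _ _
      map_smul' := fun c f => rfl } ‖A‖ fun f => ContinuousLinearMap.opNorm_comp_le A f.toCLM

theorem eval_extend (z : ℂ) (A : X →L[ℝ] X) (f : NormedComplexification X) :
    eval z (extend A f) = A (eval z f) := rfl

theorem extend_one : extend (1 : X →L[ℝ] X) = 1 := rfl

theorem extend_mul (A B : X →L[ℝ] X) : extend (A * B) = extend A * extend B := rfl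

theorem extend_sub (A B : X →L[ℝ] X) : extend (A - B) = extend A - extend B := rfl

theorem extend_pow (A : X →L[ℝ] X) (n : ℕ) : extend (A ^ n) = extend A ^ n := by
  induction n with
  | zero => simp [extend_one]
  | succ n ih => rw [pow_succ, pow_succ, extend_mul, ih]

theorem norm_extend_apply {A : X →L[ℝ] X} (hA : ∀ x, ‖A x‖ = ‖x‖) (f : NormedComplexification X) :
    ‖extend A f‖ = ‖f‖ := by
  refine le_antisymm (ContinuousLinearMap.opNorm_le_bound _ (norm_nonneg f) fun z => ?_)
    (ContinuousLinearMap.opNorm_le_bound f.toCLM (norm_nonneg _) fun z => ?_)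
  · exact (hA _).le.trans (f.toCLM.le_opNorm z)
  · rw [← hA]
    exact (extend A f).toCLM.le_opNorm z

end NormedComplexification

end Complexification

/-! ### Isometries that perturb the identity. -/

section Isometry

variable {X : Type*} [NormedAddCommGroup X] [NormedSpace ℝ X]

open NormedComplexification

/-- If `S` is strictly singular, then `1 - w • S` is, on the complexification, bounded below up to a
finite-dimensional term. -/
theorem IsStrictlySingular.exists_norm_le_extend {S : X →L[ℝ] X} (hS : IsStrictlySingular S) (w : ℂ) :
    ∃ (F : Finset (NormedComplexification X →L[ℝ] ℝ)) (C D : ℝ), 0 ≤ C ∧ 0 ≤ D ∧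
      ∀ v, ‖v‖ ≤ C * ‖(1 - w • extend S) v‖ + D * ‖evalFunctionals F v‖ := by
  set U : NormedComplexification X →L[ℝ] NormedComplexification X :=
    (1 - w • extend S).restrictScalars ℝ
  set ε : ℝ := 1 / (4 * (1 + ‖w‖))
  have hε : 0 < ε := by positivity
  rcases exists_infinite_dim_small_or_bounded_below U hε with ⟨Z, hZ, hUZ⟩ | ⟨F, c, hc, h⟩
  · exfalso
    -- Shrinking twice makes `S` small on both components of one nonzero `u`. Then `u - w • extend S
    -- u` and `extend S u` are both small; the choice of `ε` gives `‖u‖ ≤ ‖u‖ / 2`.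
    obtain ⟨Z₁, hZ₁, h₁⟩ := hS.exists_infinite_dim_small hZ (eval 1 ∘L Z.subtypeL) hε
    obtain ⟨Z₂, hZ₂, h₂⟩ := hS.exists_infinite_dim_small hZ₁
      (eval Complex.I ∘L Z.subtypeL ∘L Z₁.subtypeL) hε
    have hne : Z₂ ≠ ⊥ := by
      rintro rfl
      exact hZ₂ inferInstance
    obtain ⟨v, hv, hv0⟩ := Submodule.exists_mem_ne_zero_of_ne_bot hne
    set u : NormedComplexification X := v.1.1
    have hu : 0 < ‖u‖ := norm_pos_iff.2 fun h0 => hv0 (Subtype.ext (Subtype.ext h0))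
    have hu0 : ‖u - w • extend S u‖ ≤ ε * ‖u‖ := hUZ u v.1.2
    have hu1 : ‖S (eval 1 u)‖ ≤ ε * ‖u‖ := h₁ v.1 v.2
    have hu2 : ‖S (eval Complex.I u)‖ ≤ ε * ‖u‖ := h₂ v hv
    have h3 : ‖extend S u‖ ≤ 2 * (ε * ‖u‖) := by
      refine (norm_le_norm_eval_add _).trans ?_
      rw [eval_extend, eval_extend]
      linarith
    have h4 : ‖u‖ ≤ ε * ‖u‖ + ‖w‖ * (2 * (ε * ‖u‖)) := by
      calc ‖u‖ = ‖(u - w • extend S u) + w • extend S u‖ := by rw [sub_add_cancel]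
        _ ≤ ‖u - w • extend S u‖ + ‖w • extend S u‖ := norm_add_le _ _
        _ ≤ _ := by rw [norm_smul]; gcongr
    have h5 : ε * (1 + ‖w‖) = 1 / 4 := by simp only [ε]; field_simp
    nlinarith [mul_pos hε hu, norm_nonneg w]
  · exact ⟨F, exists_le_add_norm_evalFunctionals U hc h⟩

/-- An isometry which is a strictly singular perturbation of the identity is a compact perturbation
of the identity. -/
theorem IsStrictlySingular.isCompactOperator_of_isometry [CompleteSpace X] {T S : X →L[ℝ] X}
    (hS : IsStrictlySingular S) (hT : ∀ x, ‖T x‖ = ‖x‖) (hTS : T - 1 = S) :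
    IsCompactOperator S := by
  let ι := Metric.closedBall (0 : X) 1
  let _ : TopologicalSpace ι := ⊥
  have : DiscreteTopology ι := ⟨rfl⟩
  have hTn : ∀ (n : ℕ) x, ‖(T ^ n) x‖ = ‖x‖ := by
    intro n
    induction n with
    | zero => intro x; simp
    | succ n ih => intro x; rw [pow_succ]; exact (ih (T x)).trans (hT x)
  have hR : essentialMap ι (extend T) = 1 := by
    refine eq_one_of_powers_bounded
      (norm_essentialMap_apply_le fun v => (norm_extend_apply hT v).le) ?_ ?_
    · intro n e
      rw [← essentialMap_pow, ← extend_pow]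
      -- Isometry of `T ^ n` allows `C = 1`, `D = 0`; passing to the quotient costs the factor `2`.
      have := norm_le_essentialMap_apply (ι := ι) (0 : NormedComplexification X →L[ℝ] ℝ)
        (A := extend (T ^ n)) zero_le_one le_rfl
        (fun v => by simp [norm_extend_apply (hTn n)]) e
      simpa using this
    · intro w
      obtain ⟨F, C, D, hC, hD, h⟩ := hS.exists_norm_le_extend w
      refine ⟨2 * C, fun e => ?_⟩
      rw [← essentialMap_one_sub_smul, ← extend_one, ← extend_sub, hTS]
      exact norm_le_essentialMap_apply (evalFunctionals F) hC hD h e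
  have hSzero : essentialMap ι (extend S) = 0 := by
    rw [← hTS, extend_sub, extend_one, essentialMap_sub, essentialMap_one, hR, sub_self]
  -- The inclusion of the unit ball: its class is killed by `S` only if the image of the ball is
  -- totally bounded.
  let f : BoundedContinuousFunction ι (NormedComplexification X) :=
    BoundedContinuousFunction.ofNormedAddCommGroupDiscrete (fun x => ofReal x.1) 1
      fun x => (norm_ofReal_le _).trans (mem_closedBall_zero_iff.1 x.2)
  have htb := totallyBounded_range_of_mk_eq_zero
    (DFunLike.congr_fun hSzero (Submodule.Quotient.mk f))
  have htb' := htb.image (eval (X := X) 1).uniformContinuous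
  refine (isCompactOperator_iff_isCompact_closure_image_closedBall S.toLinearMap one_pos).2 ?_
  refine (htb'.subset ?_).closure.isCompact_of_isClosed isClosed_closure
  rintro _ ⟨x, hx, rfl⟩
  exact ⟨_, ⟨⟨x, hx⟩, rfl⟩, by
    change eval 1 (extend S (ofReal x)) = S x
    rw [eval_extend, eval_one_ofReal]⟩

/-- A strictly singular perturbation of a multiple of the identity can only be isometric if the
multiple is `1` or `-1`. -/
theorem IsStrictlySingular.abs_eq_one_of_isometry {S : X →L[ℝ] X} (hS : IsStrictlySingular S)
    (hX : ¬ FiniteDimensional ℝ X) {a : ℝ} (h : ∀ x, ‖a • x + S x‖ = ‖x‖) : |a| = 1 := by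
  have key : ∀ ε > 0, |(|a| - 1)| ≤ ε := by
    intro ε hε
    obtain ⟨Z, hZ, hSZ⟩ := hS.exists_infinite_dim_small hX (ContinuousLinearMap.id ℝ X) hε
    have hne : Z ≠ ⊥ := by
      rintro rfl
      exact hZ inferInstance
    obtain ⟨z, hz, hz0⟩ := Submodule.exists_mem_ne_zero_of_ne_bot hne
    have hz' : 0 < ‖z‖ := norm_pos_iff.2 hz0
    have h1 := abs_norm_sub_norm_le (a • z) (a • z + S z)
    rw [h, norm_smul, Real.norm_eq_abs, sub_add_cancel_left, norm_neg] at h1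
    have h2 : |(|a| - 1)| * ‖z‖ ≤ ε * ‖z‖ := by
      rw [← abs_of_pos hz', ← abs_mul, abs_of_pos hz', sub_mul, one_mul]
      exact h1.trans (hSZ z hz)
    exact le_of_mul_le_mul_right h2 hz'
  have h0 : |(|a| - 1)| ≤ 0 := le_of_forall_pos_le_add fun ε hε => by simpa using key ε hε
  exact sub_eq_zero.1 (abs_nonpos_iff.1 h0)

theorem IsStrictlySingular.neg {S : X →L[ℝ] X} (hS : IsStrictlySingular S) :
    IsStrictlySingular (-S) := by
  intro Y hY h
  exact hS Y hY (by simpa using h)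

end Isometry

theorem proposition4p3 {X : Type*} [NormedAddCommGroup X] [NormedSpace ℝ X] [CompleteSpace X]
    (hX : HasLambdaIdPlusSProperty X) (T : X →L[ℝ] X) (hT : Isometry T) :
    ∃ K : X →L[ℝ] X, IsCompactOperator K ∧
      (T = ContinuousLinearMap.id ℝ X + K ∨ T = -ContinuousLinearMap.id ℝ X + K) := by
  have hnorm : ∀ x, ‖T x‖ = ‖x‖ := fun x => by
    simpa using hT.dist_eq x 0
  by_cases hfin : FiniteDimensional ℝ X
  · refine ⟨T - ContinuousLinearMap.id ℝ X, ?_, Or.inl (by abel)⟩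
    have := FiniteDimensional.proper ℝ X
    refine (isCompactOperator_iff_isCompact_closure_image_closedBall
      (T - ContinuousLinearMap.id ℝ X).toLinearMap one_pos).2 ?_
    exact ((isCompact_closedBall (0 : X) 1).image
      (T - ContinuousLinearMap.id ℝ X).continuous).closure
  obtain ⟨a, S, hS, hTS⟩ := hX T
  have ha : |a| = 1 := hS.abs_eq_one_of_isometry hfin fun x => by
    rw [← hnorm x, hTS]; rfl
  rcases (abs_eq zero_le_one).1 ha with rfl | rfl
  · rw [one_smul] at hTS
    exact ⟨S, hS.isCompactOperator_of_isometry hnorm (sub_eq_iff_eq_add'.2 hTS), Or.inl hTS⟩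
  · rw [neg_one_smul] at hTS
    refine ⟨S, ?_, Or.inr hTS⟩
    -- For `a = -1`, the isometry `-T` equals `1 + (-S)`.
    have h := hS.neg.isCompactOperator_of_isometry (T := -T) (fun x => by simp [hnorm]) (by
      rw [hTS, ContinuousLinearMap.one_def]; abel)
    simpa using h.neg
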